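/- Let $\mathbb F$ be an algebraically closed field of characteristic zero, let $\overline{\mathbb F(x)}$ be an algebraic closure of $\mathbb F(x)$, and let $\sigma_x$ be any automorphism of $\overline{\mathbb F(x)}$ extending the shift $a(x)\mapsto a(x+1)$ of $\mathbb F(x)$. On $\overline{\mathbb F(x)}(y)$ let $\sigma_x$ act on coefficients with $\sigma_x(y)=y$, and let $\sigma_y$ be the automorphism that fixes $\overline{\mathbb F(x)}$ and sends $y$ to $y+1$. An element $f\in\overline{\mathbb F(x)}(y)$ is called $(\sigma_x,\sigma_y)$-summable in $\overline{\mathbb F(x)}(y)$ if $f=\sigma_x(g)-g+\sigma_y(h)-h$ for some $g,h\in\overline{\mathbb F(x)}(y)$. Let $j\ge 1$ be an integer and let $$f=\sum_{i=1}^m\frac{\alpha_i}{(y-\beta_i)^j},\qquad \alpha_i,\beta_i\in\overline{\mathbb F(x)},\quad \alpha_i\ne 0,$$ where $\beta_i-\sigma_x^n(\beta_{i'})\notin\mathbb Z$ for all $1\le i<i'\le m$ and all $n\in\mathbb Z$. (1) $f$ is $(\sigma_x,\sigma_y)$-summable in $\overline{\mathbb F(x)}(y)$ if and only if for each $i\in\{1,\dots,m\}$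 there are $s_i\in\mathbb Z$, an integer $t_i\ge 1$ and $c_i\in\mathbb F$ such that $\beta_i=\frac{s_i}{t_i}x+c_i$ and $\alpha_i=\sigma_x^{t_i}(\gamma_i)-\gamma_i$ for some $\gamma_i\in\overline{\mathbb F(x)}$. (2) If moreover $\alpha_i\in\mathbb F(x)(\beta_i)$ for each $i$, then $f$ is $(\sigma_x,\sigma_y)$-summable in $\overline{\mathbb F(x)}(y)$ if and only if the condition in (1) holds with $\gamma_i\in\mathbb F(x)$ for each $i$. -/

import Mathlib

/-- The field automorphism of `k(X)` induced by an automorphism of the polynomial ring `k[X]`. -/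
noncomputable def ratFuncAut {k : Type*} [Field k] (e : Polynomial k ≃+* Polynomial k) :
    RingAut (RatFunc k) :=
  IsFractionRing.ringEquivOfRingEquiv (K := RatFunc k) (L := RatFunc k) e

/-- The shift operator `f(X) ↦ f(X + 1)` on `k(X)`; it fixes `k`. It serves both as the shift in `x`
on `F(x)` and as the shift in `y` on `E(y)`. -/
noncomputable def ratFuncShift (k : Type*) [Field k] : RingAut (RatFunc k) :=
  ratFuncAut (Polynomial.algEquivAevalXAddC (1 : k)).toRingEquiv

/-- An automorphism `σ` of `k` acting on the coefficients of elements of `k(X)`; it fixes `X`. -/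
noncomputable def ratFuncCoeffAut {k : Type*} [Field k] (σ : RingAut k) : RingAut (RatFunc k) :=
  ratFuncAut (Polynomial.mapEquiv σ)

/-- `f` is `(φ, ψ)`-summable in `L`. -/
def IsSummablePair {L : Type*} [Field L] (φ ψ : RingAut L) (f : L) : Prop :=
  ∃ g h : L, f = (φ g - g) + (ψ h - h)

/-- `σ` is an extension to `E ⊇ F(x)` of the shift operator `x ↦ x + 1` of `F(x)`. -/
def ExtendsShift (F : Type*) [Field F] {E : Type*} [Field E] [Algebra (RatFunc F) E]
    (σ : RingAut E) : Prop :=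
  ∀ a : RatFunc F, σ (algebraMap (RatFunc F) E a) = algebraMap (RatFunc F) E (ratFuncShift F a)

/-! ### Laurent expansions and their polar coefficients. -/

section LaurentCoefficients

open Polynomial

variable {k : Type*} [Field k]

/-! Sum the coefficients of $(y-b')^{-j}$ over $b'\in b+\mathbb Z$. This orbit sum $S_b$ ignores
$\sigma_y$ and satisfies $S_{\sigma b}(\sigma_x g)=\sigma(S_b(g))$, so for
$f=\sigma_x(g)-g+\sigma_y(h)-h$ one gets $S_{\sigma b}(f)=\sigma(S_b(g))-S_{\sigma b}(g)$. Reading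
coefficients from Laurent series makes this work without partial fractions of $g$ and $h$.

Follow the cosets $\sigma^n\beta_i+\mathbb Z$: the hypothesis makes $\beta_i$ the only pole of $f$
there. If they never recur, finiteness of the poles of $g$ lets the recurrence be summed, forcing
$\alpha_i=0$. Hence $\sigma^t\beta_i=\beta_i+s$ for a least $t\ge1$, and going round the cycle gives
$\alpha_i=\sigma^t\gamma-\gamma$ (`eq_difference_of_summable`). Then $\beta_i-\frac st x$ is fixed
by $\sigma^t$, hence constant (`ExtendsShift.eq_constant_of_pow_apply_eq`). The converse telescopes
(`isSummablePair_polarTerm`).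

For (2), $\beta_i\in\mathbb F(x)$ forces $\alpha_i\in\mathbb F(x)$, and $\gamma$ may be replaced by
the average of its conjugates (`ExtendsShift.exists_ratFunc_of_difference`). -/

@[simp]
theorem ratFuncAut_algebraMap (e : k[X] ≃+* k[X]) (p : k[X]) :
    ratFuncAut e (algebraMap k[X] (RatFunc k) p) = algebraMap k[X] (RatFunc k) (e p) :=
  IsFractionRing.ringEquivOfRingEquiv_algebraMap e p

theorem ratFuncShift_algebraMap (p : k[X]) :
    ratFuncShift k (algebraMap k[X] (RatFunc k) p) =
      algebraMap k[X] (RatFunc k) (p.comp (X + C 1)) := by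
  simp [ratFuncShift, comp_eq_aeval]

@[simp]
theorem ratFuncShift_C (a : k) : ratFuncShift k (RatFunc.C a) = RatFunc.C a := by
  simpa using ratFuncShift_algebraMap (C a)

@[simp]
theorem ratFuncShift_X : ratFuncShift k RatFunc.X = RatFunc.X + 1 := by
  simpa using ratFuncShift_algebraMap (X : k[X])

@[simp]
theorem ratFuncCoeffAut_C (σ : RingAut k) (a : k) :
    ratFuncCoeffAut σ (RatFunc.C a) = RatFunc.C (σ a) := by
  simpa [ratFuncCoeffAut] using ratFuncAut_algebraMap (Polynomial.mapEquiv σ) (C a)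

@[simp]
theorem ratFuncCoeffAut_X (σ : RingAut k) :
    ratFuncCoeffAut σ (RatFunc.X : RatFunc k) = RatFunc.X := by
  simpa [ratFuncCoeffAut] using ratFuncAut_algebraMap (Polynomial.mapEquiv σ) X

theorem RatFunc.ringHom_ext_C_X {L : Type*} [Field L] {φ ψ : RatFunc k →+* L}
    (hC : ∀ a, φ (RatFunc.C a) = ψ (RatFunc.C a)) (hX : φ RatFunc.X = ψ RatFunc.X) : φ = ψ := by
  refine IsLocalization.ringHom_ext (nonZeroDivisors k[X]) (Polynomial.ringHom_ext ?_ ?_)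
  · intro a
    simpa using hC a
  · simpa using hX

/-- The Taylor expansion of a polynomial at the point `b`, as a Laurent series. -/
noncomputable def taylorLaurent (b : k) : k[X] →+* LaurentSeries k :=
  (HahnSeries.ofPowerSeries ℤ k).comp
    (Polynomial.coeToPowerSeries.ringHom.comp (algEquivAevalXAddC b).toRingEquiv.toRingHom)

theorem taylorLaurent_apply (b : k) (p : k[X]) :
    taylorLaurent b p =
      HahnSeries.ofPowerSeries ℤ k ((p.comp (X + C b) : k[X]) : PowerSeries k) := by
  simp [taylorLaurent, comp_eq_aeval]

theorem taylorLaurent_injective (b : k) : Function.Injective (taylorLaurent b) := by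
  refine HahnSeries.ofPowerSeries_injective.comp ?_
  exact (Polynomial.coe_injective k).comp (algEquivAevalXAddC b).injective

/-- The Laurent expansion of a rational function at the point `b`. -/
noncomputable def laurentAt (b : k) : RatFunc k →+* LaurentSeries k :=
  IsFractionRing.lift (taylorLaurent_injective b)

theorem laurentAt_algebraMap (b : k) (p : k[X]) :
    laurentAt b (algebraMap k[X] (RatFunc k) p) =
      HahnSeries.ofPowerSeries ℤ k ((p.comp (X + C b) : k[X]) : PowerSeries k) := by
  rw [laurentAt, IsFractionRing.lift_algebraMap, taylorLaurent_apply]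

@[simp]
theorem laurentAt_C (b a : k) : laurentAt b (RatFunc.C a) = HahnSeries.C a := by
  simpa using laurentAt_algebraMap b (C a)

@[simp]
theorem laurentAt_X (b : k) :
    laurentAt b RatFunc.X = HahnSeries.single 1 1 + HahnSeries.C b := by
  simpa using laurentAt_algebraMap b X

theorem laurentAt_ratFuncShift (b : k) (g : RatFunc k) :
    laurentAt b (ratFuncShift k g) = laurentAt (b + 1) g := by
  have : (laurentAt b).comp (ratFuncShift k : RatFunc k ≃+* RatFunc k).toRingHom =
      laurentAt (b + 1) := by
    refine RatFunc.ringHom_ext_C_X (fun a => ?_) ?_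
    · simp
    · simp [add_assoc]
  exact DFunLike.congr_fun this g

/-- Application of an automorphism to the coefficients of a Laurent series. -/
noncomputable def laurentMap (σ : RingAut k) : LaurentSeries k →+* LaurentSeries k where
  toFun s := s.map (σ : k ≃+* k).toRingHom
  map_one' := by ext n; simp [HahnSeries.coeff_one, apply_ite]
  map_zero' := by ext n; simp
  map_add' s t := by ext n; simp
  map_mul' s t := HahnSeries.map_mul ((σ : k ≃+* k).toRingHom : k →ₙ+* k)

theorem coeff_laurentMap (σ : RingAut k) (s : LaurentSeries k) (n : ℤ) :
    (laurentMap σ s).coeff n = σ (s.coeff n) := rfl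

theorem laurentMap_single (σ : RingAut k) (n : ℤ) (a : k) :
    laurentMap σ (HahnSeries.single n a) = HahnSeries.single n (σ a) := by
  ext i
  rw [coeff_laurentMap]
  by_cases h : i = n
  · simp [h]
  · simp [HahnSeries.coeff_single_of_ne h]

theorem laurentAt_ratFuncCoeffAut (σ : RingAut k) (b : k) (g : RatFunc k) :
    laurentAt (σ b) (ratFuncCoeffAut σ g) = laurentMap σ (laurentAt b g) := by
  have : (laurentAt (σ b)).comp (ratFuncCoeffAut σ : RatFunc k ≃+* RatFunc k).toRingHom =
      (laurentMap σ).comp (laurentAt b) := by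
    refine RatFunc.ringHom_ext_C_X (fun a => ?_) ?_
    · simp [HahnSeries.C_apply, laurentMap_single]
    · simp [HahnSeries.C_apply, laurentMap_single]
  exact DFunLike.congr_fun this g

/-- The coefficient of `(X - b)⁻ʲ` in the Laurent expansion at `b`. -/
noncomputable def polarCoeff (j : ℕ) (b : k) : RatFunc k →+ k where
  toFun g := (laurentAt b g).coeff (-j)
  map_zero' := by simp
  map_add' := by simp

theorem polarCoeff_apply (j : ℕ) (b : k) (g : RatFunc k) :
    polarCoeff j b g = (laurentAt b g).coeff (-j) := rfl

theorem polarCoeff_ratFuncShift (j : ℕ) (b : k) (g : RatFunc k) :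
    polarCoeff j b (ratFuncShift k g) = polarCoeff j (b + 1) g := by
  simp only [polarCoeff_apply, laurentAt_ratFuncShift]

theorem polarCoeff_ratFuncCoeffAut (σ : RingAut k) (j : ℕ) (b : k) (g : RatFunc k) :
    polarCoeff j (σ b) (ratFuncCoeffAut σ g) = σ (polarCoeff j b g) := by
  simp only [polarCoeff_apply, laurentAt_ratFuncCoeffAut, coeff_laurentMap]

/-- A denominator not vanishing at $b$ expands to an invertible power series, so no negative
exponents occur. -/
theorem polarCoeff_div_eq_zero {j : ℕ} (hj : 1 ≤ j) {b : k} (p : k[X]) {q : k[X]}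
    (hq : q.eval b ≠ 0) :
    polarCoeff j b (algebraMap k[X] (RatFunc k) p / algebraMap k[X] (RatFunc k) q) = 0 := by
  set Q : PowerSeries k := ((q.comp (X + C b) : k[X]) : PowerSeries k) with hQ
  have hQ0 : PowerSeries.constantCoeff Q ≠ 0 := by
    simpa [hQ, Polynomial.constantCoeff_coe, coeff_zero_eq_eval_zero, eval_comp] using hq
  have hne : HahnSeries.ofPowerSeries ℤ k Q ≠ 0 := by
    rw [Ne, map_eq_zero_iff _ HahnSeries.ofPowerSeries_injective]
    rintro h
    simp [h] at hQ0
  have : laurentAt b (algebraMap k[X] (RatFunc k) p / algebraMap k[X] (RatFunc k) q) =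
      HahnSeries.ofPowerSeries ℤ k (((p.comp (X + C b) : k[X]) : PowerSeries k) * Q⁻¹) := by
    rw [map_div₀, laurentAt_algebraMap, laurentAt_algebraMap, ← hQ, div_eq_iff hne, ← map_mul,
      mul_assoc, PowerSeries.inv_mul_cancel _ hQ0, mul_one]
  rw [polarCoeff_apply, this]
  have := PowerSeries.coeff_coe (((p.comp (X + C b) : k[X]) : PowerSeries k) * Q⁻¹) (-j : ℤ)
  rw [this, if_pos (by omega)]

theorem finite_polarCoeff_ne_zero {j : ℕ} (hj : 1 ≤ j) (g : RatFunc k) :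
    {b : k | polarCoeff j b g ≠ 0}.Finite := by
  refine (g.denom.rootSet_finite k).subset fun b hb => ?_
  by_contra h
  apply hb
  rw [← RatFunc.num_div_denom g]
  refine polarCoeff_div_eq_zero hj _ fun h0 => h ?_
  rw [Polynomial.mem_rootSet]
  exact ⟨g.denom_ne_zero, by simpa using h0⟩

/-- The simple polar term `a / (X - b) ^ j`. -/
noncomputable def polarTerm (j : ℕ) (a b : k) : RatFunc k :=
  RatFunc.C a / (RatFunc.X - RatFunc.C b) ^ j

theorem polarCoeff_polarTerm [DecidableEq k] {j : ℕ} (hj : 1 ≤ j) (a b c : k) :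
    polarCoeff j c (polarTerm j a b) = if c = b then a else 0 := by
  split_ifs with h
  · subst h
    have : (HahnSeries.single 1 1 : LaurentSeries k) ≠ 0 := by simp
    have key : laurentAt c (polarTerm j a c) = HahnSeries.single (-j : ℤ) a := by
      rw [polarTerm, map_div₀, map_pow, map_sub, laurentAt_C, laurentAt_X, laurentAt_C,
        add_sub_cancel_right, div_eq_iff (pow_ne_zero _ this), HahnSeries.single_pow,
        HahnSeries.single_mul_single]
      simp [HahnSeries.C_apply]
    rw [polarCoeff_apply, key, HahnSeries.coeff_single_same]
  · have : polarTerm j a b = algebraMap k[X] (RatFunc k) (C a) /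
        algebraMap k[X] (RatFunc k) ((X - C b) ^ j) := by
      simp [polarTerm]
    rw [this]
    exact polarCoeff_div_eq_zero hj _ (by simpa [sub_eq_zero] using fun h' => absurd h' h)

@[simp]
theorem polarTerm_sub (j : ℕ) (a a' b : k) :
    polarTerm j (a - a') b = polarTerm j a b - polarTerm j a' b := by
  simp [polarTerm, sub_div]

@[simp]
theorem ratFuncCoeffAut_polarTerm (σ : RingAut k) (j : ℕ) (a b : k) :
    ratFuncCoeffAut σ (polarTerm j a b) = polarTerm j (σ a) (σ b) := by
  simp [polarTerm]

theorem ratFuncShift_polarTerm (j : ℕ) (a b : k) :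
    ratFuncShift k (polarTerm j a (b + 1)) = polarTerm j a b := by
  simp [polarTerm, add_sub_add_right_eq_sub]

end LaurentCoefficients

/-! ### Fixed elements and differences for powers of the shift. -/

section ShiftInvariants

open Polynomial

theorem Polynomial.eq_C_of_comp_X_add_C_eq {k : Type*} [Field k] {p : k[X]} {c : k}
    [CharZero k] (hc : c ≠ 0) (h : p.comp (X + C c) = p) : p = C (p.eval 0) := by
  have hn : ∀ n : ℕ, p.eval (n * c) = p.eval 0 := by
    intro n
    induction n with
    | zero => simp
    | succ n ih =>
      rw [← ih]
      conv_rhs => rw [← h]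
      simp [add_mul]
  refine Polynomial.eq_of_infinite_eval_eq _ _ ((Set.infinite_range_of_injective
    (f := fun n : ℕ => (n : k) * c) fun m n hmn => ?_).mono ?_)
  · simpa [hc] using hmn
  · rintro _ ⟨n, rfl⟩
    simp [hn]

theorem ratFuncShift_pow_algebraMap {k : Type*} [Field k] (n : ℕ) (p : k[X]) :
    (ratFuncShift k ^ n) (algebraMap k[X] (RatFunc k) p) =
      algebraMap k[X] (RatFunc k) (p.comp (X + C (n : k))) := by
  induction n with
  | zero => simp
  | succ n ih =>
    rw [pow_succ', RingAut.mul_apply, ih, ratFuncShift_algebraMap, comp_assoc]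
    simp [add_assoc, add_comm]

/-- In lowest terms, the shifted denominator is monic of the same degree and divisible by the
original, so both numerator and denominator are shift-invariant polynomials, hence constant. -/
theorem RatFunc.eq_C_of_ratFuncShift_pow_eq {k : Type*} [Field k] [CharZero k] {n : ℕ}
    (hn : n ≠ 0) {a : RatFunc k} (h : (ratFuncShift k ^ n) a = a) : ∃ c, a = RatFunc.C c := by
  have hn' : (n : k) ≠ 0 := by exact_mod_cast hn
  set T : k[X] := Polynomial.X + Polynomial.C (n : k) with hT
  have hdeg : ∀ q : k[X], (q.comp T).natDegree = q.natDegree := by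
    intro q; rw [natDegree_comp, hT, natDegree_X_add_C, mul_one]
  have hden : algebraMap k[X] (RatFunc k) a.denom ≠ 0 := RatFunc.algebraMap_ne_zero a.denom_ne_zero
  have hden' : algebraMap k[X] (RatFunc k) (a.denom.comp T) ≠ 0 := by
    rw [← ratFuncShift_pow_algebraMap]
    exact (map_ne_zero_iff _ (RingEquiv.injective _)).2 hden
  have hcross : a.num.comp T * a.denom = a.num * a.denom.comp T := by
    have h1 : algebraMap k[X] (RatFunc k) (a.num.comp T) /
        algebraMap k[X] (RatFunc k) (a.denom.comp T) =
        algebraMap k[X] (RatFunc k) a.num / algebraMap k[X] (RatFunc k) a.denom := by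
      rw [← ratFuncShift_pow_algebraMap, ← ratFuncShift_pow_algebraMap, ← map_div₀,
        RatFunc.num_div_denom, h]
    rw [div_eq_div_iff hden' hden, ← map_mul, ← map_mul] at h1
    exact RatFunc.algebraMap_injective k h1
  have hdvd : a.denom ∣ a.denom.comp T :=
    a.isCoprime_num_denom.symm.dvd_of_dvd_mul_left ⟨_, by rw [← hcross, mul_comm]⟩
  have hmon : (a.denom.comp T).Monic := a.monic_denom.comp_X_add_C _
  have hq : a.denom.comp T = a.denom :=
    eq_of_monic_of_dvd_of_natDegree_le a.monic_denom hmon hdvd (hdeg _).le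
  have hp : a.num.comp T = a.num := by
    rw [hq] at hcross
    exact mul_right_cancel₀ a.denom_ne_zero hcross
  refine ⟨a.num.eval 0 / a.denom.eval 0, ?_⟩
  conv_lhs => rw [← RatFunc.num_div_denom a, eq_C_of_comp_X_add_C_eq hn' hp,
    eq_C_of_comp_X_add_C_eq hn' hq]
  simp

theorem minpoly_ringEquiv_apply {K L : Type*} [Field K] [Field L] [Algebra K L]
    (τ : K ≃+* K) (σ : L ≃+* L) (h : ∀ a, σ (algebraMap K L a) = algebraMap K L (τ a))
    {x : L} (hx : IsIntegral K x) :
    minpoly K (σ x) = (minpoly K x).map (τ : K →+* K) := by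
  symm
  refine minpoly.eq_of_irreducible_of_monic ?_ ?_ ((minpoly.monic hx).map _)
  · exact (MulEquiv.irreducible_iff (Polynomial.mapEquiv τ)).2 (minpoly.irreducible hx)
  · have hc : (algebraMap K L).comp (τ : K →+* K) = (σ : L →+* L).comp (algebraMap K L) := by
      ext a; simp [h]
    rw [aeval_def, eval₂_map, hc]
    have := hom_eval₂ (minpoly K x) (algebraMap K L) (σ : L →+* L) x
    rw [← aeval_def, minpoly.aeval, map_zero] at this
    exact this.symm

/-- `nextCoeff` is minus the sum of the roots in an algebraic closure, and the substitution adds $a$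
to each root. -/
theorem Polynomial.Monic.nextCoeff_comp_X_sub_C {R : Type*} [Field R] {p : R[X]}
    (hp : p.Monic) (a : R) : (p.comp (X - C a)).nextCoeff = p.nextCoeff - p.natDegree * a := by
  classical
  let A := AlgebraicClosure R
  apply (algebraMap R A).injective
  rw [← nextCoeff_map (algebraMap R A).injective, map_sub,
    ← nextCoeff_map (algebraMap R A).injective, Polynomial.map_comp,
    ← natDegree_map_eq_of_injective (algebraMap R A).injective p]
  have hs := IsAlgClosed.splits (p.map (algebraMap R A))
  have hm := hp.map (algebraMap R A)
  obtain ⟨m, hm'⟩ : ∃ m : Multiset A, p.map (algebraMap R A) = (m.map fun b => X - C b).prod :=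
    ⟨_, by simpa [hm] using hs.eq_prod_roots⟩
  rw [hm', natDegree_multiset_prod_X_sub_C_eq_card]
  have h1 : ((m.map fun b => X - C b).prod).comp ((X - C a).map (algebraMap R A)) =
      ((m.map fun b => b + algebraMap R A a).map fun b => X - C b).prod := by
    rw [Polynomial.multiset_prod_comp, Multiset.map_map, Multiset.map_map]
    congr 1
    refine Multiset.map_congr rfl fun b _ => ?_
    simp [sub_sub, add_comm]
  rw [h1, multiset_prod_X_sub_C_nextCoeff, multiset_prod_X_sub_C_nextCoeff]
  simp [Multiset.sum_map_add]
  ring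

variable {F : Type*} [Field F] {E : Type*} [Field E] [Algebra (RatFunc F) E]

theorem ExtendsShift.pow_apply {σ : RingAut E} (hσ : ExtendsShift F σ) (n : ℕ) (a : RatFunc F) :
    (σ ^ n) (algebraMap (RatFunc F) E a) = algebraMap (RatFunc F) E ((ratFuncShift F ^ n) a) := by
  induction n with
  | zero => simp
  | succ n ih => rw [pow_succ', RingAut.mul_apply, ih, hσ, pow_succ', RingAut.mul_apply]

theorem ExtendsShift.pow_apply_X {σ : RingAut E} (hσ : ExtendsShift F σ) (n : ℕ) :
    (σ ^ n) (algebraMap (RatFunc F) E RatFunc.X) = algebraMap (RatFunc F) E RatFunc.X + n := by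
  rw [hσ.pow_apply, ← RatFunc.algebraMap_X, ratFuncShift_pow_algebraMap]
  simp

theorem ExtendsShift.pow_apply_C {σ : RingAut E} (hσ : ExtendsShift F σ) (n : ℕ) (c : F) :
    (σ ^ n) (algebraMap (RatFunc F) E (RatFunc.C c)) =
      algebraMap (RatFunc F) E (RatFunc.C c) := by
  rw [hσ.pow_apply, ← RatFunc.algebraMap_C, ratFuncShift_pow_algebraMap]
  simp

/-- The minimal polynomial of $x$ has shift-invariant, hence constant, coefficients; so $x$ is
algebraic over the algebraically closed $F$. -/
theorem ExtendsShift.eq_constant_of_pow_apply_eq [CharZero F] [IsAlgClosed F]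
    [Algebra.IsAlgebraic (RatFunc F) E] {σ : RingAut E} (hσ : ExtendsShift F σ) {n : ℕ} (hn : n ≠ 0) {x : E}
    (hx : (σ ^ n) x = x) : ∃ c : F, x = algebraMap (RatFunc F) E (RatFunc.C c) := by
  have hint : IsIntegral (RatFunc F) x := Algebra.IsIntegral.isIntegral x
  have hmin := minpoly_ringEquiv_apply (ratFuncShift F ^ n) (σ ^ n) (hσ.pow_apply n) hint
  rw [hx] at hmin
  have hlift : minpoly (RatFunc F) x ∈ Polynomial.lifts (RatFunc.C : F →+* RatFunc F) := by
    rw [Polynomial.lifts_iff_coeff_lifts]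
    intro i
    have hi := congrArg (fun p => p.coeff i) hmin
    simp only [coeff_map] at hi
    obtain ⟨c, hc⟩ := RatFunc.eq_C_of_ratFuncShift_pow_eq hn hi.symm
    exact ⟨c, hc.symm⟩
  obtain ⟨P, hP, -, hPm⟩ := Polynomial.lifts_and_natDegree_eq_and_monic hlift (minpoly.monic hint)
  let _ : Algebra F E := ((algebraMap (RatFunc F) E).comp RatFunc.C).toAlgebra
  have hxF : IsIntegral F x := by
    refine ⟨P, hPm, ?_⟩
    have h0 := minpoly.aeval (RatFunc F) x
    rw [← hP, aeval_def, eval₂_map] at h0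
    exact h0
  obtain ⟨c, hc⟩ := minpoly.mem_range_of_degree_eq_one F x
    (IsAlgClosed.degree_eq_one_of_irreducible F (minpoly.irreducible hxF))
  exact ⟨c, hc.symm⟩

theorem ExtendsShift.exists_ratFunc_of_difference [CharZero F] [Algebra.IsAlgebraic (RatFunc F) E]
    {σ : RingAut E} (hσ : ExtendsShift F σ) {n : ℕ} {a : RatFunc F} {x : E}
    (h : algebraMap (RatFunc F) E a = (σ ^ n) x - x) :
    ∃ γ : RatFunc F, algebraMap (RatFunc F) E a =
      (σ ^ n) (algebraMap (RatFunc F) E γ) - algebraMap (RatFunc F) E γ := by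
  have hint : IsIntegral (RatFunc F) x := Algebra.IsIntegral.isIntegral x
  have hmin := minpoly_ringEquiv_apply (ratFuncShift F ^ n) (σ ^ n) (hσ.pow_apply n) hint
  rw [← sub_add_cancel ((σ ^ n) x) x, ← h, add_comm, minpoly.add_algebraMap] at hmin
  have hnext := congrArg nextCoeff hmin
  rw [(minpoly.monic hint).nextCoeff_comp_X_sub_C, nextCoeff_map (RingHom.injective _)] at hnext
  have hd : ((minpoly (RatFunc F) x).natDegree : RatFunc F) ≠ 0 := by
    have : CharZero (RatFunc F) :=
      charZero_of_injective_algebraMap (algebraMap F (RatFunc F)).injective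
    exact_mod_cast (minpoly.natDegree_pos hint).ne'
  -- The mean of the conjugates of $x$: translating $x$ by $a$ translates this mean by $a$.
  refine ⟨-(minpoly (RatFunc F) x).nextCoeff / (minpoly (RatFunc F) x).natDegree, ?_⟩
  rw [hσ.pow_apply, ← map_sub]
  congr 1
  rw [map_div₀, map_neg, map_natCast]
  replace hnext : _ = (ratFuncShift F ^ n) (minpoly (RatFunc F) x).nextCoeff := hnext
  rw [← hnext]
  field_simp
  ring

end ShiftInvariants

/-! ### Orbit sums and the necessary condition. -/

section OrbitSums

variable {k : Type*} [Field k]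

/-- The sum of the coefficients of order `j` at the points of `b + ℤ`. -/
noncomputable def orbitSum (j : ℕ) (b : k) (g : RatFunc k) : k :=
  ∑ᶠ n : ℤ, polarCoeff j (b + n) g

theorem finite_support_polarCoeff_add_int [CharZero k] {j : ℕ} (hj : 1 ≤ j) (b : k)
    (g : RatFunc k) : (Function.support fun n : ℤ => polarCoeff j (b + n) g).Finite :=
  (finite_polarCoeff_ne_zero hj g).preimage (f := fun n : ℤ => b + (n : k))
    fun m _ n _ h => by simpa using h

theorem orbitSum_add [CharZero k] {j : ℕ} (hj : 1 ≤ j) (b : k) (g h : RatFunc k) :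
    orbitSum j b (g + h) = orbitSum j b g + orbitSum j b h := by
  simp only [orbitSum, map_add]
  exact finsum_add_distrib (finite_support_polarCoeff_add_int hj b g)
    (finite_support_polarCoeff_add_int hj b h)

theorem orbitSum_sub [CharZero k] {j : ℕ} (hj : 1 ≤ j) (b : k) (g h : RatFunc k) :
    orbitSum j b (g - h) = orbitSum j b g - orbitSum j b h := by
  rw [eq_sub_iff_add_eq, ← orbitSum_add hj, sub_add_cancel]

theorem orbitSum_add_int (j : ℕ) (b : k) (s : ℤ) (g : RatFunc k) :
    orbitSum j (b + s) g = orbitSum j b g := by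
  rw [orbitSum, orbitSum,
    ← finsum_comp_equiv (Equiv.addLeft s) (f := fun n : ℤ => polarCoeff j (b + n) g)]
  simp [add_assoc]

theorem orbitSum_ratFuncShift (j : ℕ) (b : k) (g : RatFunc k) :
    orbitSum j b (ratFuncShift k g) = orbitSum j b g := by
  rw [← orbitSum_add_int j b 1 g]
  simp only [orbitSum, polarCoeff_ratFuncShift]
  simp [add_right_comm]

theorem orbitSum_ratFuncCoeffAut [CharZero k] (σ : RingAut k) {j : ℕ} (hj : 1 ≤ j) (b : k)
    (g : RatFunc k) : orbitSum j (σ b) (ratFuncCoeffAut σ g) = σ (orbitSum j b g) := by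
  have h := (σ : k ≃+* k).toAddMonoidHom.map_finsum (finite_support_polarCoeff_add_int hj b g)
  refine Eq.trans ?_ h.symm
  refine finsum_congr fun n => ?_
  have := polarCoeff_ratFuncCoeffAut σ j (b + n) g
  simpa using this

theorem orbitSum_summable [CharZero k] (σ : RingAut k) {j : ℕ} (hj : 1 ≤ j) (b : k)
    (g h : RatFunc k) :
    orbitSum j (σ b) ((ratFuncCoeffAut σ g - g) + (ratFuncShift k h - h)) =
      σ (orbitSum j b g) - orbitSum j (σ b) g := by
  rw [orbitSum_add hj, orbitSum_sub hj, orbitSum_sub hj, orbitSum_ratFuncShift, sub_self,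
    add_zero, orbitSum_ratFuncCoeffAut σ hj]

theorem orbitSum_eq_of_polarCoeff_eq_ite [DecidableEq k] [CharZero k] {j : ℕ} {b b₀ a : k}
    {f : RatFunc k} (hf : ∀ n : ℤ, polarCoeff j (b + n) f = if b + n = b₀ then a else 0)
    {s : ℤ} (hs : b + s = b₀) : orbitSum j b f = a := by
  rw [orbitSum, finsum_eq_single _ s, hf, if_pos hs]
  intro n hn
  rw [hf, if_neg]
  rw [← hs]
  simpa using hn

theorem orbitSum_eq_zero_of_polarCoeff_eq_ite [DecidableEq k] {j : ℕ} {b b₀ a : k}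
    {f : RatFunc k} (hf : ∀ n : ℤ, polarCoeff j (b + n) f = if b + n = b₀ then a else 0)
    (hs : ∀ s : ℤ, b + s ≠ b₀) : orbitSum j b f = 0 := by
  rw [orbitSum, ← finsum_zero (α := ℤ)]
  exact finsum_congr fun n => by rw [hf, if_neg (hs n)]

/-- By injectivity each of the finitely many poles of $g$ lies in at most one coset $\sigma^n
b+\mathbb Z$. -/
theorem finite_orbitSum_ne_zero {j : ℕ} (hj : 1 ≤ j) (σ : RingAut k) {b : k}
    (hinj : Function.Injective fun p : ℤ × ℤ => (σ ^ p.1) b + (p.2 : k)) (g : RatFunc k) :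
    {n : ℤ | orbitSum j ((σ ^ n) b) g ≠ 0}.Finite := by
  refine (((finite_polarCoeff_ne_zero hj g).preimage hinj.injOn).image Prod.fst).subset
    fun n hn => ?_
  by_contra h
  refine hn ?_
  rw [orbitSum, ← finsum_zero (α := ℤ)]
  refine finsum_congr fun s => ?_
  by_contra hs
  exact h ⟨(n, s), hs, rfl⟩

/-- If `b` is the only pole in its orbit of a summable function, then some `σ ^ t` translates `b` by
an integer, and the coefficient at `b` is a difference for `σ ^ t`. -/
theorem eq_difference_of_summable [CharZero k] [DecidableEq k] (σ : RingAut k) {j : ℕ}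
    (hj : 1 ≤ j) {a b : k} (ha : a ≠ 0) {g h : RatFunc k}
    (hf : ∀ n s : ℤ, polarCoeff j ((σ ^ n) b + s)
      ((ratFuncCoeffAut σ g - g) + (ratFuncShift k h - h)) =
        if (σ ^ n) b + s = b then a else 0) :
    ∃ (t : ℕ) (s : ℤ), 1 ≤ t ∧ (σ ^ t) b = b + s ∧ ∃ γ, a = (σ ^ t) γ - γ := by
  have hstep : ∀ n : ℤ, (σ ^ (n + 1)) b = σ ((σ ^ n) b) := fun n => by
    rw [add_comm, zpow_add, zpow_one, RingAut.mul_apply]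
  -- Does the coset $b+\mathbb Z$ recur under $\sigma$?
  by_cases hex : ∃ t : ℕ, 1 ≤ t ∧ ∃ s : ℤ, (σ ^ t) b = b + s
  · classical
    obtain ⟨ht, s, hs⟩ := Nat.find_spec hex
    have hmin : ∀ n : ℕ, n < Nat.find hex → 1 ≤ n → ∀ s : ℤ, (σ ^ n) b + s ≠ b := by
      intro n hn h1 s hs
      exact Nat.find_min hex hn ⟨h1, -s, by
        rw [← eq_sub_iff_add_eq] at hs
        simpa [sub_eq_add_neg] using hs⟩
    set t := Nat.find hex with htdef
    clear_value t
    have hnat : ∀ n : ℕ, (σ ^ (n + 1)) b = σ ((σ ^ n) b) := fun n => by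
      rw [pow_succ', RingAut.mul_apply]
    have hf' : ∀ (n : ℕ) (s : ℤ), polarCoeff j ((σ ^ n) b + s)
        ((ratFuncCoeffAut σ g - g) + (ratFuncShift k h - h)) =
          if (σ ^ n) b + s = b then a else 0 := fun n => by simpa using hf n
    -- Before the first return the cosets miss $b$, so the orbit sums of $f$ vanish and those of $g$
    -- are carried along by $\sigma$.
    have hrec : ∀ n : ℕ, n < t → orbitSum j ((σ ^ n) b) g = (σ ^ n) (orbitSum j b g) := by
      intro n
      induction n with
      | zero => simp
      | succ n ih =>
        intro hn
        have h0 := orbitSum_eq_zero_of_polarCoeff_eq_ite (hf' (n + 1))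
          (hmin (n + 1) hn (by omega))
        rw [hnat, orbitSum_summable σ hj, sub_eq_zero, ih (by omega)] at h0
        rw [hnat, ← h0, pow_succ', RingAut.mul_apply]
    refine ⟨t, s, ht, hs, orbitSum j b g, ?_⟩
    obtain ⟨n, rfl⟩ : ∃ n, t = n + 1 := ⟨t - 1, by omega⟩
    have h1 := orbitSum_eq_of_polarCoeff_eq_ite (hf' (n + 1)) (s := -s) (by rw [hs]; simp)
    rw [hnat, orbitSum_summable σ hj, ← hnat, hs, orbitSum_add_int, hrec n (by omega)] at h1
    rw [← h1, pow_succ', RingAut.mul_apply]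
  · exfalso
    push Not at hex
    have hfree : ∀ n s : ℤ, (σ ^ n) b = b + s → n = 0 := by
      intro n s hn
      obtain ⟨m, rfl | rfl⟩ := n.eq_nat_or_neg
      · by_contra h0
        exact hex m (by omega) s (by simpa using hn)
      · by_contra h0
        refine hex m (by omega) (-s) ?_
        have := congrArg (σ ^ m) hn
        rw [← RingAut.mul_apply, zpow_neg, zpow_natCast, mul_inv_cancel, RingAut.one_apply,
          map_add, map_intCast] at this
        rw [Int.cast_neg, ← sub_eq_add_neg]
        exact eq_sub_of_add_eq this.symm
    have hinj : Function.Injective fun p : ℤ × ℤ => (σ ^ p.1) b + (p.2 : k) := by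
      rintro ⟨n, s⟩ ⟨n', s'⟩ hp
      simp only at hp
      have h1 : (σ ^ (n - n')) b = b + ((s' - s : ℤ) : k) := by
        have := congrArg (σ ^ (-n')) (eq_sub_of_add_eq hp)
        rw [← RingAut.mul_apply, ← zpow_add, add_sub_assoc, map_add, map_sub, map_intCast,
          map_intCast, ← RingAut.mul_apply, ← zpow_add, neg_add_cancel, zpow_zero, RingAut.one_apply] at this
        rw [sub_eq_neg_add, this]
        simp
      have h2 : n = n' := by have := hfree _ _ h1; omega
      subst h2
      simpa using hp
    have hfin := finite_orbitSum_ne_zero hj σ hinj g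
    -- Pulling back by $\sigma^{-n}$ turns the recurrence into a plain difference, which sums to
    -- zero over $\mathbb Z$ by finite support.
    set A : ℤ → k := fun n => (σ ^ (-n)) (orbitSum j ((σ ^ n) b) g) with hA
    have hsupp : (Function.support A).Finite := by
      refine hfin.subset fun n hn h0 => hn ?_
      simp [hA, h0]
    have hsupp' : (Function.support fun n => A (n - 1)).Finite :=
      hsupp.preimage (f := fun n : ℤ => n - 1) fun m _ n _ h => by simpa using h
    have hdiff : ∀ n, A (n - 1) - A n = if n = 0 then a else 0 := by
      intro n
      obtain ⟨n, rfl⟩ : ∃ m, n = m + 1 := ⟨n - 1, by ring⟩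
      have h1 : A n - A (n + 1) = (σ ^ (-(n + 1))) (orbitSum j ((σ ^ (n + 1)) b)
          ((ratFuncCoeffAut σ g - g) + (ratFuncShift k h - h))) := by
        rw [hstep, orbitSum_summable σ hj, ← hstep, map_sub]
        congr 1
        rw [hA]
        have : σ (orbitSum j ((σ ^ n) b) g) = (σ ^ (1 : ℤ)) (orbitSum j ((σ ^ n) b) g) := by simp
        rw [this, ← RingAut.mul_apply, ← zpow_add,
          show -(n + 1) + 1 = -n by ring]
      rw [add_sub_cancel_right, h1]
      split_ifs with h0
      · rw [h0, orbitSum_eq_of_polarCoeff_eq_ite (s := 0) (hf 0) (by simp)]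
        simp
      · rw [orbitSum_eq_zero_of_polarCoeff_eq_ite (hf (n + 1)), map_zero]
        intro s hs
        refine h0 (hfree (n + 1) (-s) ?_)
        rw [← eq_sub_iff_add_eq] at hs
        simpa [sub_eq_add_neg] using hs
    have hsum := finsum_sub_distrib hsupp' hsupp
    have hcomp : ∑ᶠ n, A (n - 1) = ∑ᶠ n, A n := finsum_comp_equiv (Equiv.subRight (1 : ℤ))
    rw [hcomp, sub_self, finsum_congr hdiff,
      finsum_eq_single _ 0 (fun n hn => if_neg hn), if_pos rfl] at hsum
    exact ha hsum

end OrbitSums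

/-! ### Telescoping, and the shape of the poles. -/

section Summability

theorem IsSummablePair.add {L : Type*} [Field L] {φ ψ : RingAut L} {f g : L}
    (hf : IsSummablePair φ ψ f) (hg : IsSummablePair φ ψ g) : IsSummablePair φ ψ (f + g) := by
  obtain ⟨u, v, rfl⟩ := hf
  obtain ⟨u', v', rfl⟩ := hg
  exact ⟨u + u', v + v', by simp only [map_add]; ring⟩

theorem IsSummablePair.sum {L ι : Type*} [Field L] {φ ψ : RingAut L} (s : Finset ι) {f : ι → L}
    (hf : ∀ i ∈ s, IsSummablePair φ ψ (f i)) : IsSummablePair φ ψ (∑ i ∈ s, f i) :=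
  Finset.sum_induction f _ (fun _ _ => IsSummablePair.add) ⟨0, 0, by simp⟩ hf

/-- $\varphi^t-1=(\varphi-1)(1+\varphi+\dots+\varphi^{t-1})$. -/
theorem exists_pow_apply_sub_eq {L : Type*} [Field L] (φ : RingAut L) (t : ℕ) (g : L) :
    ∃ g', (φ ^ t) g - g = φ g' - g' := by
  induction t with
  | zero => exact ⟨0, by simp⟩
  | succ t ih =>
    obtain ⟨g', hg'⟩ := ih
    refine ⟨(φ ^ t) g + g', ?_⟩
    rw [pow_succ', RingAut.mul_apply, map_add]
    linear_combination hg'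

theorem ratFuncCoeffAut_pow_polarTerm {k : Type*} [Field k] (σ : RingAut k) (t j : ℕ) (a b : k) :
    (ratFuncCoeffAut σ ^ t) (polarTerm j a b) = polarTerm j ((σ ^ t) a) ((σ ^ t) b) := by
  induction t with
  | zero => simp
  | succ t ih => simp only [pow_succ', RingAut.mul_apply, ih, ratFuncCoeffAut_polarTerm]

theorem exists_polarTerm_sub_polarTerm_add_int {k : Type*} [Field k] (j : ℕ) (a b : k) (s : ℤ) :
    ∃ h, polarTerm j a b - polarTerm j a (b + s) = ratFuncShift k h - h := by
  induction s using Int.induction_on with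
  | zero => exact ⟨0, by simp⟩
  | succ n ih =>
    obtain ⟨h, hh⟩ := ih
    refine ⟨h + polarTerm j a (b + n + 1), ?_⟩
    rw [map_add, ratFuncShift_polarTerm]
    push_cast at hh ⊢
    rw [← add_assoc]
    linear_combination hh
  | pred n ih =>
    obtain ⟨h, hh⟩ := ih
    refine ⟨h - polarTerm j a (b - n), ?_⟩
    have h1 := ratFuncShift_polarTerm j a (b - n - 1)
    rw [sub_add_cancel] at h1
    rw [map_sub, h1]
    push_cast at hh ⊢
    rw [← sub_eq_add_neg] at hh
    rw [show b + (-(n : k) - 1) = b - n - 1 by ring]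
    linear_combination hh

/-- Insert the term with numerator $\sigma^t\gamma$ at $b+s$: it is the image of $\gamma/(y-b)^j$
under $\sigma_x^t$, and differs from the same numerator at $b$ by a $\sigma_y$-difference. -/
theorem isSummablePair_polarTerm {k : Type*} [Field k] (σ : RingAut k) (j t : ℕ) {b : k} {s : ℤ}
    (hb : (σ ^ t) b = b + s) (γ : k) :
    IsSummablePair (ratFuncCoeffAut σ) (ratFuncShift k) (polarTerm j ((σ ^ t) γ - γ) b) := by
  obtain ⟨g, hg⟩ := exists_pow_apply_sub_eq (ratFuncCoeffAut σ) t (polarTerm j γ b)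
  obtain ⟨h, hh⟩ := exists_polarTerm_sub_polarTerm_add_int j ((σ ^ t) γ) b s
  refine ⟨g, h, ?_⟩
  rw [← hg, ← hh, ratFuncCoeffAut_pow_polarTerm, hb, polarTerm_sub]
  ring

theorem zpow_apply_add_int_ne {k : Type*} [Field k] {σ : RingAut k} {a b : k}
    (h : ∀ n s : ℤ, a - (σ ^ n) b ≠ s) (n s : ℤ) : (σ ^ n) a + s ≠ b := by
  intro heq
  refine h (-n) (-s) ?_
  rw [← heq, map_add, map_intCast, ← RingAut.mul_apply, ← zpow_add, neg_add_cancel, zpow_zero,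
    RingAut.one_apply]
  simp

theorem polarCoeff_sum_polarTerm {k ι : Type*} [Field k] [DecidableEq k] [Fintype ι]
    [LinearOrder ι] {σ : RingAut k} {j : ℕ} (hj : 1 ≤ j) {α β : ι → k}
    (hβ : ∀ i i', i < i' → ∀ n s : ℤ, β i - (σ ^ n) (β i') ≠ (s : k)) (i : ι) (n s : ℤ) :
    polarCoeff j ((σ ^ n) (β i) + s) (∑ i', polarTerm j (α i') (β i')) =
      if (σ ^ n) (β i) + s = β i then α i else 0 := by
  rw [map_sum, Finset.sum_eq_single i, polarCoeff_polarTerm hj]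
  · intro i' _ hi'
    rw [polarCoeff_polarTerm hj, if_neg]
    -- The separation hypothesis covers only $i<i'$; the other order follows by applying a power of
    -- $\sigma$.
    rcases lt_or_gt_of_ne hi' with h | h
    · intro heq
      refine hβ i' i h n s ?_
      rw [← heq]
      simp
    · exact zpow_apply_add_int_ne (hβ i i' h) n s
  · simp

variable {F : Type*} [Field F] {E : Type*} [Field E] [Algebra (RatFunc F) E]

theorem ExtendsShift.exists_eq_linear [CharZero F] [IsAlgClosed F] [CharZero E]
    [Algebra.IsAlgebraic (RatFunc F) E] {σ : RingAut E} (hσ : ExtendsShift F σ) {t : ℕ}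
    (ht : 1 ≤ t) {b : E} {s : ℤ} (hb : (σ ^ t) b = b + s) :
    ∃ c : F, b = (s : E) / (t : E) * algebraMap (RatFunc F) E RatFunc.X
      + algebraMap (RatFunc F) E (RatFunc.C c) := by
  have ht' : (t : E) ≠ 0 := by exact_mod_cast (by omega : t ≠ 0)
  obtain ⟨c, hc⟩ := hσ.eq_constant_of_pow_apply_eq (n := t) (by omega)
    (x := b - (s : E) / (t : E) * algebraMap (RatFunc F) E RatFunc.X) (by
      rw [map_sub, map_mul, map_div₀, map_intCast, map_natCast, hσ.pow_apply_X, hb]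
      field_simp
      ring)
  exact ⟨c, by rw [← hc]; ring⟩

theorem ExtendsShift.pow_apply_linear [CharZero E] {σ : RingAut E} (hσ : ExtendsShift F σ) {t : ℕ}
    (ht : 1 ≤ t) (s : ℤ) (c : F) :
    (σ ^ t) ((s : E) / (t : E) * algebraMap (RatFunc F) E RatFunc.X
      + algebraMap (RatFunc F) E (RatFunc.C c)) = ((s : E) / (t : E) *
        algebraMap (RatFunc F) E RatFunc.X + algebraMap (RatFunc F) E (RatFunc.C c)) + s := by
  have ht' : (t : E) ≠ 0 := by exact_mod_cast (by omega : t ≠ 0)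
  rw [map_add, map_mul, map_div₀, map_intCast, map_natCast, hσ.pow_apply_X, hσ.pow_apply_C]
  field_simp
  ring

end Summability

/-! ### The summability criterion. -/

theorem theorem3p4 {F : Type*} [Field F] [IsAlgClosed F] [CharZero F]
    {E : Type*} [Field E] [Algebra (RatFunc F) E] [IsAlgClosure (RatFunc F) E]
    (σ : RingAut E) (hσ : ExtendsShift F σ)
    (m j : ℕ) (hj : 1 ≤ j) (α β : Fin m → E) (hα : ∀ i, α i ≠ 0)
    (hβ : ∀ i i' : Fin m, i < i' → ∀ n k : ℤ, β i - (σ ^ n) (β i') ≠ (k : E))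
    (f : RatFunc E)
    (hf : f = ∑ i, RatFunc.C (α i) / (RatFunc.X - RatFunc.C (β i)) ^ j) :
    (IsSummablePair (ratFuncCoeffAut σ) (ratFuncShift E) f ↔
      ∀ i, ∃ (s : ℤ) (t : ℕ) (c : F), 1 ≤ t ∧
        β i = (s : E) / (t : E) * algebraMap (RatFunc F) E RatFunc.X
          + algebraMap (RatFunc F) E (RatFunc.C c) ∧
        ∃ γ : E, α i = (σ ^ t) γ - γ) ∧
    ((∀ i, α i ∈ IntermediateField.adjoin (RatFunc F) {β i}) →
      (IsSummablePair (ratFuncCoeffAut σ) (ratFuncShift E) f ↔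
        ∀ i, ∃ (s : ℤ) (t : ℕ) (c : F), 1 ≤ t ∧
          β i = (s : E) / (t : E) * algebraMap (RatFunc F) E RatFunc.X
            + algebraMap (RatFunc F) E (RatFunc.C c) ∧
          ∃ γ : RatFunc F, α i = (σ ^ t) (algebraMap (RatFunc F) E γ)
            - algebraMap (RatFunc F) E γ)) := by
  classical
  have : Algebra.IsAlgebraic (RatFunc F) E := IsAlgClosure.isAlgebraic
  have : CharZero (RatFunc F) :=
    charZero_of_injective_algebraMap (algebraMap F (RatFunc F)).injective
  have : CharZero E := charZero_of_injective_algebraMap (algebraMap (RatFunc F) E).injective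
  have hf' : f = ∑ i, polarTerm j (α i) (β i) := hf
  have key : IsSummablePair (ratFuncCoeffAut σ) (ratFuncShift E) f ↔
      ∀ i, ∃ (s : ℤ) (t : ℕ) (c : F), 1 ≤ t ∧
        β i = (s : E) / (t : E) * algebraMap (RatFunc F) E RatFunc.X
          + algebraMap (RatFunc F) E (RatFunc.C c) ∧
        ∃ γ : E, α i = (σ ^ t) γ - γ := by
    constructor
    · rintro ⟨g, h, hgh⟩ i
      obtain ⟨t, s, ht, hs, hγ⟩ := eq_difference_of_summable σ hj (hα i) (b := β i) (g := g)
        (h := h) fun n s => by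
          rw [← hgh, hf']
          exact polarCoeff_sum_polarTerm hj hβ i n s
      obtain ⟨c, hc⟩ := hσ.exists_eq_linear ht hs
      exact ⟨s, t, c, ht, hc, hγ⟩
    · intro H
      rw [hf']
      refine IsSummablePair.sum _ fun i _ => ?_
      obtain ⟨s, t, c, ht, hb, γ, hγ⟩ := H i
      rw [hγ]
      exact isSummablePair_polarTerm σ j t (by rw [hb]; exact hσ.pow_apply_linear ht s c) γ
  refine ⟨key, fun hmem => key.trans (forall_congr' fun i => ?_)⟩
  constructor
  · rintro ⟨s, t, c, ht, hb, γ, hγ⟩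
    refine ⟨s, t, c, ht, hb, ?_⟩
    -- Since $\beta_i$ is rational, adjoining it adds nothing, so $\alpha_i$ is rational too.
    have hβi : β i ∈ (⊥ : IntermediateField (RatFunc F) E) := by
      refine IntermediateField.mem_bot.2 ⟨(s : RatFunc F) / (t : RatFunc F) * RatFunc.X + RatFunc.C c, ?_⟩
      rw [hb]
      simp
    have hαi := hmem i
    rw [IntermediateField.adjoin_simple_eq_bot_iff.2 hβi, IntermediateField.mem_bot] at hαi
    obtain ⟨a, ha⟩ := hαi
    rw [← ha] at hγ ⊢
    exact hσ.exists_ratFunc_of_difference hγ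
  · rintro ⟨s, t, c, ht, hb, γ, hγ⟩
    exact ⟨s, t, c, ht, hb, _, hγ⟩
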